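/- Let $n\ge 0$ and let $d\mu_n(u)=\prod_{j=1}^n e^{-|u_j|^2}\,\frac{dx_j\,dy_j}{\pi}$ ($u_j=x_j+iy_j$) be the Gaussian measure on $\mathbb C^n$. Let $\mathcal H$ be the Hilbert space of anti-holomorphic functions $u\mapsto g(\bar u)$ ($g$ entire on $\mathbb C^n$) that belong to $L^2(\mathbb C^n,d\mu_n)$, with inner product $\langle g|h\rangle=\int\overline{g(\bar u)}\,h(\bar u)\,d\mu_n(u)$ (the $n$-mode holomorphic, or Bargmann, representation). Let $a_j=\partial/\partial\bar u_j$ and $a_j^\dagger=\bar u_j$ (multiplication) be the annihilation and creation operators in $\mathcal H$, each on its maximal domain. A unitary operator $U$ on $\mathcal H$ is said to have the integral kernel $U(\bar u,v)$ if, for all $g\in\mathcal H$ and all $u\in\mathbb C^n$, $$(Ug)(\bar u)=\int U(\bar u,v)\,g(\bar v)\,d\mu_n(v),$$ the integral being absolutely convergent. Theorem 4.1. Let $f_1,\dots,f_n\in\mathbb C$. The linear canonical transformation $$b_j=a_j+f_j,\qquad b_j^\dagger=a_j^\dagger+\bar f_j\qquad(j=1,\dots,n)$$ is implemented by the unitary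 operator $U$ on $\mathcal H$, i.e. $b_j=Ua_jU^\dagger$ and $b_j^\dagger=Ua_j^\dagger U^\dagger$ for all $j$ (as unbounded operators, domains included), whose integral kernel is $$U(\bar u,v)=c\,\exp\sum_{j=1}^n\bigl(\bar u_jv_j+v_j\bar f_j-\bar u_jf_j\bigr),\qquad c=\theta\exp\Bigl\{-\tfrac12\sum_{j=1}^n\bar f_jf_j\Bigr\},\quad|\theta|=1.$$ More precisely: for every $\theta\in\mathbb C$ with $|\theta|=1$ there is exactly one unitary operator $U$ on $\mathcal H$ with this integral kernel, and it implements the transformation; conversely, every unitary operator on $\mathcal H$ that implements the transformation has this integral kernel for some $\theta$ with $|\theta|=1$. -/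

import Mathlib

open MeasureTheory
open scoped InnerProductSpace

noncomputable section

namespace Bargmann

/-- The Gaussian measure `dμ_n = ∏ⱼ e^{-|uⱼ|²} dxⱼ dyⱼ / π`, `uⱼ = xⱼ + i yⱼ`, on `ℂⁿ`. -/
def gaussian (n : ℕ) : Measure (Fin n → ℂ) :=
  volume.withDensity fun u => ENNReal.ofReal (∏ j, Real.exp (-‖u j‖ ^ 2) / Real.pi)

/-- The entire functions `F` on `ℂⁿ` such that the antiholomorphic function `u ↦ F(ū)` is square
integrable with respect to `dμ_n`. An antiholomorphic function of `u` is recorded as the function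
`F` of the variable `ū`. -/
def holoL2 (n : ℕ) : Submodule ℂ ((Fin n → ℂ) → ℂ) where
  carrier := {F | Differentiable ℂ F ∧ MemLp (fun u => F (star u)) 2 (gaussian n)}
  zero_mem' := ⟨differentiable_const 0, MemLp.zero⟩
  add_mem' hF hG := ⟨hF.1.add hG.1, hF.2.add hG.2⟩
  smul_mem' c _ hF := ⟨hF.1.const_smul c, hF.2.const_smul c⟩

/-- The Hilbert space of the holomorphic (Bargmann) representation with `n` degrees of freedom.
This is a type of its own so that it does not inherit the topology of pointwise convergence. -/
def Space (n : ℕ) : Type := holoL2 n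

variable {n : ℕ}

instance : AddCommGroup (Space n) := inferInstanceAs (AddCommGroup (holoL2 n))

instance : Module ℂ (Space n) := inferInstanceAs (Module ℂ (holoL2 n))

instance : CoeFun (Space n) (fun _ => (Fin n → ℂ) → ℂ) := ⟨fun F => F.1⟩

theorem integrable_inner (F G : Space n) :
    Integrable (fun u => star (F (star u)) * G (star u)) (gaussian n) :=
  F.2.2.star.integrable_mul G.2.2

theorem eq_zero_of_integral (F : Space n)
    (h : ∫ u, star (F (star u)) * F (star u) ∂gaussian n = 0) : F = 0 := by
  have hd : Measurable fun u : Fin n → ℂ =>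
      ENNReal.ofReal (∏ j, Real.exp (-‖u j‖ ^ 2) / Real.pi) := by
    fun_prop
  have hc : Continuous fun u : Fin n → ℂ => F (star u) :=
    F.2.1.continuous.comp continuous_star
  have h1 : ∫ u, ‖F (star u)‖ ^ 2 ∂gaussian n = 0 := by
    have h2 : ∀ u, star (F (star u)) * F (star u) = ((‖F (star u)‖ ^ 2 : ℝ) : ℂ) := fun u => by
      rw [Complex.ofReal_pow]
      exact Complex.conj_mul' _
    simp_rw [h2] at h
    rw [integral_complex_ofReal] at h
    exact_mod_cast h
  rw [integral_eq_zero_iff_of_nonneg (fun u => by positivity)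
    (F.2.2.integrable_norm_pow (by norm_num))] at h1
  have h3 : ∀ᵐ u ∂(volume : Measure (Fin n → ℂ)), ‖F (star u)‖ ^ 2 = 0 := by
    rw [gaussian, Filter.EventuallyEq, ae_withDensity_iff hd] at h1
    filter_upwards [h1] with u hu
    refine hu (ne_of_gt (ENNReal.ofReal_pos.2 (Finset.prod_pos fun j _ => ?_)))
    positivity
  have h4 : (fun u : Fin n → ℂ => ‖F (star u)‖ ^ 2) = fun _ => (0 : ℝ) :=
    (Continuous.ae_eq_iff_eq volume (hc.norm.pow 2) continuous_const).1 h3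
  refine Subtype.ext (funext fun w => ?_)
  have h5 := congrFun h4 (star w)
  change F w = 0
  simpa using h5

/-- The inner product `⟨F|G⟩ = ∫ conj (F(ū)) G(ū) dμ_n(u)`. -/
@[reducible] def core : InnerProductSpace.Core ℂ (Space n) where
  inner F G := ∫ u, star (F (star u)) * G (star u) ∂gaussian n
  conj_inner_symm F G := by
    rw [← integral_conj]
    refine integral_congr_ae (Filter.Eventually.of_forall fun u => ?_)
    simp [mul_comm]
  re_inner_nonneg F := by
    have h2 : ∀ u, star (F (star u)) * F (star u) = ((‖F (star u)‖ ^ 2 : ℝ) : ℂ) := fun u => by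
      rw [Complex.ofReal_pow]
      exact Complex.conj_mul' _
    simp_rw [h2]
    rw [integral_complex_ofReal]
    exact integral_nonneg fun u => by positivity
  add_left F G H := by
    rw [← integral_add (integrable_inner F H) (integrable_inner G H)]
    refine integral_congr_ae (Filter.Eventually.of_forall fun u => ?_)
    change star (F (star u) + G (star u)) * _ = _
    rw [star_add, add_mul]
  smul_left F G c := by
    rw [← integral_const_mul]
    refine integral_congr_ae (Filter.Eventually.of_forall fun u => ?_)
    change star (c * F (star u)) * _ = star c * _
    rw [star_mul', mul_assoc]
  definite F h := eq_zero_of_integral F h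

instance : NormedAddCommGroup (Space n) := core.toNormedAddCommGroup

instance : InnerProductSpace ℂ (Space n) := InnerProductSpace.ofCore core.toCore

/-- The partial derivative `∂F/∂wⱼ` of an entire function `F(w)`, as a linear map on the entire
functions which belong to the Bargmann space. -/
def partialDeriv (j : Fin n) : Space n →ₗ[ℂ] ((Fin n → ℂ) → ℂ) where
  toFun F w := fderiv ℂ F w (Pi.single j 1)
  map_add' F G := funext fun w => by
    change fderiv ℂ (F.1 + G.1) w _ = _
    rw [fderiv_add (F.2.1 w) (G.2.1 w)]
    rfl
  map_smul' c F := funext fun w => by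
    change fderiv ℂ (c • F.1) w _ = _
    rw [fderiv_const_smul (F.2.1 w)]
    rfl

/-- Multiplication by the coordinate `wⱼ`. -/
def mulCoord (j : Fin n) : Space n →ₗ[ℂ] ((Fin n → ℂ) → ℂ) where
  toFun F w := w j * F w
  map_add' F G := funext fun w => mul_add (w j) (F w) (G w)
  map_smul' c F := funext fun w => mul_left_comm (w j) c (F w)

/-- The operator in the Bargmann space given by a linear map `T` into functions, on its maximal
domain: all `F` for which `T F` is again in the Bargmann space. -/
def maximal (T : Space n →ₗ[ℂ] ((Fin n → ℂ) → ℂ)) : Space n →ₗ.[ℂ] Space n where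
  domain := (holoL2 n).comap T
  toFun :=
    { toFun := fun F => (⟨T F, F.2⟩ : holoL2 n)
      map_add' := fun F G => Subtype.ext (T.map_add F G)
      map_smul' := fun c F => Subtype.ext (T.map_smul c F) }

/-- The annihilation operator `aⱼ = ∂/∂ūⱼ`. -/
def annihilation (j : Fin n) : Space n →ₗ.[ℂ] Space n := maximal (partialDeriv j)

/-- The creation operator `aⱼ† = ūⱼ`. -/
def creation (j : Fin n) : Space n →ₗ.[ℂ] Space n := maximal (mulCoord j)

/-- The unbounded operator `A + z·1`, with the domain of `A`. -/
def addScalar (A : Space n →ₗ.[ℂ] Space n) (z : ℂ) : Space n →ₗ.[ℂ] Space n where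
  domain := A.domain
  toFun := A.toFun + z • A.domain.subtype

/-- The unbounded operator `U A U†`, with domain `U (dom A)`, for a unitary operator `U`. -/
def conjugate (U : Space n ≃ₗᵢ[ℂ] Space n) (A : Space n →ₗ.[ℂ] Space n) :
    Space n →ₗ.[ℂ] Space n where
  domain := A.domain.comap U.symm.toLinearEquiv.toLinearMap
  toFun :=
    { toFun := fun G => U (A ⟨U.symm G, G.2⟩)
      map_add' := fun G H => by
        rw [← map_add, ← LinearPMap.map_add]
        congr 2
        exact Subtype.ext (U.symm.map_add _ _)
      map_smul' := fun c G => by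
        rw [RingHom.id_apply, ← map_smul, ← LinearPMap.map_smul]
        congr 2
        exact Subtype.ext (U.symm.map_smul _ _) }

/-- The unitary operator `U` implements the transformation `bⱼ = aⱼ + fⱼ`, `bⱼ† = aⱼ† + conj fⱼ`:
one has `bⱼ = U aⱼ U†` and `bⱼ† = U aⱼ† U†`, including equality of the domains. -/
def Implements (f : Fin n → ℂ) (U : Space n ≃ₗᵢ[ℂ] Space n) : Prop :=
  ∀ j, addScalar (annihilation j) (f j) = conjugate U (annihilation j) ∧
    addScalar (creation j) (star (f j)) = conjugate U (creation j)

/-- The operator `U` has the integral kernel `K(ū, v)`: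
`(U g)(ū) = ∫ K(ū, v) g(v̄) dμ_n(v)` for all `g` and all `ū`, the integrals being convergent. -/
def HasKernel (U : Space n ≃ₗᵢ[ℂ] Space n) (K : (Fin n → ℂ) → (Fin n → ℂ) → ℂ) : Prop :=
  ∀ (g : Space n) (w : Fin n → ℂ),
    Integrable (fun v => K w v * g (star v)) (gaussian n) ∧
      U g w = ∫ v, K w v * g (star v) ∂gaussian n

/-- The function `θ exp(-½ Σⱼ f̄ⱼ fⱼ) exp Σⱼ (ūⱼ vⱼ + vⱼ f̄ⱼ - ūⱼ fⱼ)` of `w = ū` and `v`. -/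
def shiftKernel (f : Fin n → ℂ) (θ : ℂ) (w v : Fin n → ℂ) : ℂ :=
  θ * Complex.exp (-(1 / 2) * ∑ j, star (f j) * f j) *
    Complex.exp (∑ j, (w j * v j + v j * star (f j) - w j * f j))

end Bargmann

end

open MeasureTheory
open scoped InnerProductSpace

noncomputable section

namespace Bargmann

variable {n : ℕ}

/-! Everything reduces to the weighted translation `(V F)(w) = θ exp(-½|f|² - w·f) F(w + f̄)`.
Completing the square turns the Gaussian weight times the squared modulus of the factor into the
weight at `u + f`, so `V` is unitary by translation invariance of Lebesgue measure
(`density_mul_shiftFactor`, `shift`).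

The mean value property gives `⟨1|F⟩ = F 0`. Translating the vacuum by `V` yields coherent states
`e_z` with `⟨e_z|F⟩ = F z` (`inner_coherent`). The stated kernel is, up to a factor depending only
on `w`, the conjugate of `e_{w + f̄}`, so having that kernel means being `V`. The product rule shows
that `V` implements the transformation.

Conversely, if `U` implements it, then `U⁻¹ e_z` is a joint eigenvector of the `aⱼ`, hence a
multiple of `e_{z + f̄}`. Pairing with `g` gives `(U g)(z) = c(z) g(z + f̄)`. Here `c = U 1` is
itself a joint eigenvector, with eigenvalues `-fⱼ`, so it is an exponential, and `U = V` for some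
constant `θ`. Unitarity forces `|θ| = 1`. -/

/-! ### Gaussian measure and the mean value property. -/

/-- The density of the Gaussian measure with respect to the Lebesgue measure. -/
def density (u : Fin n → ℂ) : ℝ := ∏ j, Real.exp (-‖u j‖ ^ 2) / Real.pi

theorem density_pos (u : Fin n → ℂ) : 0 < density u :=
  Finset.prod_pos fun _ _ => by positivity

theorem continuous_density : Continuous (density (n := n)) := by
  unfold density
  fun_prop

theorem measurable_ofReal_density :
    Measurable fun u : Fin n → ℂ => ENNReal.ofReal (density u) :=
  continuous_density.measurable.ennreal_ofReal

theorem gaussian_eq :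
    gaussian n = volume.withDensity fun u => ENNReal.ofReal (density u) := rfl

theorem integral_gaussian (h : (Fin n → ℂ) → ℂ) :
    ∫ u, h u ∂gaussian n = ∫ u, (density u : ℂ) * h u := by
  rw [gaussian_eq, integral_withDensity_eq_integral_toReal_smul measurable_ofReal_density
    (Filter.Eventually.of_forall fun _ => ENNReal.ofReal_lt_top)]
  simp [ENNReal.toReal_ofReal (density_pos _).le]

theorem integrable_gaussian_iff {h : (Fin n → ℂ) → ℂ} :
    Integrable h (gaussian n) ↔ Integrable fun u => (density u : ℂ) * h u := by
  rw [gaussian_eq, integrable_withDensity_iff_integrable_smul' measurable_ofReal_density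
    (Filter.Eventually.of_forall fun _ => ENNReal.ofReal_lt_top)]
  simp [ENNReal.toReal_ofReal (density_pos _).le]

theorem integral_exp_neg_norm_sq : ∫ z : ℂ, Real.exp (-‖z‖ ^ 2) = Real.pi := by
  have h := Complex.integral_exp_neg_rpow (p := 2) (by norm_num)
  norm_num at h
  exact h

theorem integral_density : ∫ u : Fin n → ℂ, density u = 1 := by
  unfold density
  rw [integral_fintype_prod_volume_eq_prod (𝕜 := ℝ) (E := fun _ : Fin n => ℂ)
    (fun _ z => Real.exp (-‖z‖ ^ 2) / Real.pi)]
  simp_rw [integral_div, integral_exp_neg_norm_sq]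
  simp [Real.pi_ne_zero]

instance : IsProbabilityMeasure (gaussian n) where
  measure_univ := by
    have hi : Integrable (density (n := n)) := by
      -- A non-integrable function has integral `0` by convention, but this integral is `1`.
      by_contra h
      have := integral_undef h
      rw [integral_density] at this
      exact one_ne_zero this
    rw [gaussian_eq, withDensity_apply _ MeasurableSet.univ, setLIntegral_univ,
      ← ofReal_integral_eq_lintegral_ofReal hi
        (Filter.Eventually.of_forall fun u => (density_pos u).le), integral_density,
      ENNReal.ofReal_one]

/-- The Gaussian measure is invariant under the multiplication by a phase. -/
theorem measurePreserving_phase {a : ℂ} (ha : ‖a‖ = 1) :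
    MeasurePreserving (fun u : Fin n → ℂ => a • u) (gaussian n) (gaussian n) := by
  have h1 : MeasurePreserving (fun z : ℂ => a * z) :=
    (rotation ⟨a, by simpa [Submonoid.unitSphere] using ha⟩).measurePreserving
  have h2 : MeasurePreserving (fun u : Fin n → ℂ => a • u) :=
    volume_preserving_pi (f := fun (_ : Fin n) (z : ℂ) => a * z) fun _ => h1
  have hd : ∀ u : Fin n → ℂ, density (a • u) = density u := fun u => by
    simp [density, ha]
  refine ⟨h2.measurable, Measure.ext fun s hs => ?_⟩
  rw [Measure.map_apply h2.measurable hs, gaussian_eq, withDensity_apply _ hs,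
    withDensity_apply _ (h2.measurable hs),
    ← h2.setLIntegral_comp_preimage hs measurable_ofReal_density]
  simp_rw [hd]

/-- The mean value property of entire functions with respect to the Gaussian measure. -/
theorem integral_star_eq_apply_zero {F : (Fin n → ℂ) → ℂ} (hF : Differentiable ℂ F)
    (hi : Integrable (fun u => F (star u)) (gaussian n)) :
    ∫ u, F (star u) ∂gaussian n = F 0 := by
  -- One-variable mean value property on the complex line through `w`. Averaging the integral over
  -- phases and using Fubini then gives the claim.
  have hmean : ∀ w : Fin n → ℂ, (2 * Real.pi)⁻¹ •
      ∫ t in (0 : ℝ)..2 * Real.pi, F (Complex.exp (t * Complex.I) • w) = F 0 := fun w => by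
    have h1 : Differentiable ℂ fun z : ℂ => F (z • w) := by fun_prop
    have h2 := (h1.diffContOnCl (s := Metric.ball 0 |1|)).circleAverage
    simpa [Real.circleAverage, circleMap] using h2
  have hnorm : ∀ t : ℝ, ‖star (Complex.exp (t * Complex.I))‖ = 1 := fun t => by
    rw [norm_star, Complex.norm_exp_ofReal_mul_I]
  have hcomp : ∀ (t : ℝ) (u : Fin n → ℂ),
      F (Complex.exp (t * Complex.I) • star u) =
        (fun u => F (star u)) (star (Complex.exp (t * Complex.I)) • u) := fun t u => by
    simp only [star_smul, star_star]
  have hcF := hF.continuous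
  have hcs : Continuous fun u : Fin n → ℂ => F (star u) := hcF.comp continuous_star
  have hrot : ∀ t : ℝ, ∫ u, F (Complex.exp (t * Complex.I) • star u) ∂gaussian n =
      ∫ u, F (star u) ∂gaussian n := fun t => by
    simp_rw [hcomp]
    rw [← integral_map (measurePreserving_phase (hnorm t)).measurable.aemeasurable
      hcs.aestronglyMeasurable,
      (measurePreserving_phase (hnorm t)).map_eq]
  have hrotn : ∀ t : ℝ, ∫ u, ‖F (Complex.exp (t * Complex.I) • star u)‖ ∂gaussian n =
      ∫ u, ‖F (star u)‖ ∂gaussian n := fun t => by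
    simp_rw [hcomp]
    rw [← integral_map (f := fun u => ‖F (star u)‖)
      (measurePreserving_phase (hnorm t)).measurable.aemeasurable
      hcs.norm.aestronglyMeasurable,
      (measurePreserving_phase (hnorm t)).map_eq]
  have hint : ∀ t : ℝ, Integrable (fun u => F (Complex.exp (t * Complex.I) • star u))
      (gaussian n) := fun t => by
    simp_rw [hcomp]
    exact (measurePreserving_phase (hnorm t)).integrable_comp_of_integrable
      (g := fun u => F (star u)) hi
  set ν : Measure ℝ := volume.restrict (Set.Ioc 0 (2 * Real.pi)) with hν
  have hprod : Integrable (Function.uncurry fun (t : ℝ) (u : Fin n → ℂ) =>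
      F (Complex.exp (t * Complex.I) • star u)) (ν.prod (gaussian n)) := by
    rw [integrable_prod_iff]
    · refine ⟨Filter.Eventually.of_forall hint, ?_⟩
      simp only [Function.uncurry_apply_pair, hrotn]
      exact integrable_const _
    · have hc : Continuous fun p : ℝ × (Fin n → ℂ) =>
          Complex.exp (p.1 * Complex.I) • star p.2 :=
        (Complex.continuous_exp.comp ((Complex.continuous_ofReal.comp continuous_fst).mul
          continuous_const)).smul (continuous_star.comp continuous_snd)
      exact (hcF.comp hc).aestronglyMeasurable
  have hpi : (0 : ℝ) ≤ 2 * Real.pi := by positivity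
  have hswap := integral_integral_swap hprod
  simp_rw [hrot, hν, ← intervalIntegral.integral_of_le hpi] at hswap
  have h3 : ∀ w : Fin n → ℂ,
      ∫ t in (0 : ℝ)..2 * Real.pi, F (Complex.exp (t * Complex.I) • w) =
        (2 * Real.pi) • F 0 := fun w => by
    rw [← hmean w, smul_smul, mul_inv_cancel₀ (by positivity), one_smul]
  simp_rw [h3] at hswap
  simp only [intervalIntegral.integral_const, sub_zero, integral_const, probReal_univ,
    one_smul] at hswap
  exact smul_right_injective ℂ (by positivity : 2 * Real.pi ≠ 0) hswap

/-! ### The unitary shift operator. -/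

/-- The exponential factor `exp (-½ Σⱼ f̄ⱼ fⱼ - Σⱼ wⱼ fⱼ)` of the shift operator. -/
def shiftFactor (f w : Fin n → ℂ) : ℂ :=
  Complex.exp (-(1 / 2) * ∑ j, star (f j) * f j - ∑ j, w j * f j)

/-- The shift operator `F ↦ θ exp (-½ Σⱼ f̄ⱼ fⱼ - Σⱼ wⱼ fⱼ) F (w + f̄)` on functions. -/
def shiftFun (f : Fin n → ℂ) (θ : ℂ) : ((Fin n → ℂ) → ℂ) →ₗ[ℂ] ((Fin n → ℂ) → ℂ) where
  toFun F w := θ * shiftFactor f w * F (w + star f)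
  map_add' F G := funext fun _ => mul_add _ (F _) (G _)
  map_smul' c F := funext fun _ => mul_left_comm _ c (F _)

theorem shiftFun_apply (f : Fin n → ℂ) (θ : ℂ) (F : (Fin n → ℂ) → ℂ) (w : Fin n → ℂ) :
    shiftFun f θ F w = θ * shiftFactor f w * F (w + star f) := rfl

theorem shiftFactor_neg_mul (f w : Fin n → ℂ) :
    shiftFactor (-f) w * shiftFactor f (w + star (-f)) = 1 := by
  rw [shiftFactor, shiftFactor, ← Complex.exp_add]
  refine (congrArg Complex.exp ?_).trans Complex.exp_zero
  simp only [Finset.mul_sum, ← Finset.sum_sub_distrib, ← Finset.sum_add_distrib]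
  refine Finset.sum_eq_zero fun j _ => ?_
  simp only [Pi.neg_apply, Pi.add_apply, Pi.star_apply, star_neg]
  ring

theorem star_mul_self_of_norm_eq_one {θ : ℂ} (hθ : ‖θ‖ = 1) : star θ * θ = 1 := by
  have h : star θ * θ = (‖θ‖ : ℂ) ^ 2 := Complex.conj_mul' θ
  rw [h, hθ]
  simp

theorem shiftFun_neg_shiftFun {θ : ℂ} (hθ : ‖θ‖ = 1) (f : Fin n → ℂ) (F : (Fin n → ℂ) → ℂ) :
    shiftFun (-f) (star θ) (shiftFun f θ F) = F := by
  funext w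
  rw [shiftFun_apply, shiftFun_apply]
  have h1 : w + star (-f) + star f = w := by rw [star_neg]; abel
  rw [h1]
  linear_combination F w * shiftFactor (-f) w * shiftFactor f (w + star (-f)) *
    star_mul_self_of_norm_eq_one hθ + F w * shiftFactor_neg_mul f w

theorem shiftFun_shiftFun_neg {θ : ℂ} (hθ : ‖θ‖ = 1) (f : Fin n → ℂ) (F : (Fin n → ℂ) → ℂ) :
    shiftFun f θ (shiftFun (-f) (star θ) F) = F := by
  have h := shiftFun_neg_shiftFun (θ := star θ) (by rwa [norm_star]) (-f) F
  rwa [neg_neg, star_star] at h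

/-- Completing the square: `-|u|² - |f|² - 2 Re (ū·f) = -|u + f|²`. This is the source of unitarity
and fixes the constant `exp(-½|f|²)`. -/
theorem density_mul_shiftFactor (f u : Fin n → ℂ) :
    (density u : ℂ) * (star (shiftFactor f (star u)) * shiftFactor f (star u)) =
      density (u + f) := by
  have h1 : ∀ v : Fin n → ℂ, (density v : ℂ) =
      Complex.exp (-∑ j, star (v j) * v j) * ∏ _j : Fin n, (Real.pi : ℂ)⁻¹ := fun v => by
    rw [density, ← Finset.sum_neg_distrib, Complex.exp_sum, ← Finset.prod_mul_distrib]
    push_cast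
    refine Finset.prod_congr rfl fun j _ => ?_
    rw [div_eq_mul_inv]
    congr 2
    rw [← Complex.conj_mul' (v j)]
    rfl
  have h2 : star (shiftFactor f (star u)) =
      Complex.exp (-(1 / 2) * ∑ j, star (f j) * f j - ∑ j, u j * star (f j)) := by
    rw [shiftFactor]
    refine (Complex.exp_conj _).symm.trans ?_
    congr 1
    simp [mul_comm, Complex.conj_ofNat]
  rw [h1, h1, h2, shiftFactor, mul_right_comm, ← Complex.exp_add, ← Complex.exp_add]
  congr 2
  simp only [Finset.mul_sum, ← Finset.sum_sub_distrib, ← Finset.sum_add_distrib,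
    ← Finset.sum_neg_distrib]
  refine Finset.sum_congr rfl fun j _ => ?_
  simp only [Pi.add_apply, Pi.star_apply, star_add]
  ring

theorem density_mul_shiftFun {θ : ℂ} (hθ : ‖θ‖ = 1) (f : Fin n → ℂ) (F G : (Fin n → ℂ) → ℂ)
    (u : Fin n → ℂ) :
    (density u : ℂ) * (star (shiftFun f θ F (star u)) * shiftFun f θ G (star u)) =
      density (u + f) * (star (F (star (u + f))) * G (star (u + f))) := by
  rw [← density_mul_shiftFactor, shiftFun_apply, shiftFun_apply, star_mul', star_mul', star_add]
  linear_combination (density u : ℂ) * star (shiftFactor f (star u)) *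
    shiftFactor f (star u) * star (F (star u + star f)) * G (star u + star f) *
    star_mul_self_of_norm_eq_one hθ

theorem differentiable_shiftFactor (f : Fin n → ℂ) : Differentiable ℂ (shiftFactor f) := by
  unfold shiftFactor
  fun_prop

theorem differentiable_shiftFun (f : Fin n → ℂ) (θ : ℂ) {F : (Fin n → ℂ) → ℂ}
    (hF : Differentiable ℂ F) : Differentiable ℂ (shiftFun f θ F) := by
  change Differentiable ℂ fun w => θ * shiftFactor f w * F (w + star f)
  have := differentiable_shiftFactor f
  fun_prop

theorem memLp_two_iff {F : (Fin n → ℂ) → ℂ} (hF : Differentiable ℂ F) :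
    MemLp (fun u => F (star u)) 2 (gaussian n) ↔
      Integrable (fun u => (density u : ℂ) * (star (F (star u)) * F (star u))) := by
  have hc : Continuous fun u : Fin n → ℂ => F (star u) := hF.continuous.comp continuous_star
  rw [memLp_two_iff_integrable_sq_norm hc.aestronglyMeasurable, ← integrable_gaussian_iff]
  have h2 : ∀ u, star (F (star u)) * F (star u) = ((‖F (star u)‖ ^ 2 : ℝ) : ℂ) := fun u => by
    rw [Complex.ofReal_pow]
    exact Complex.conj_mul' _
  simp_rw [h2]
  exact ⟨fun h => h.ofReal, fun h => by simpa only [RCLike.ofReal_re, RCLike.re_to_complex,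
    Complex.ofReal_re] using h.re⟩

theorem shiftFun_mem {θ : ℂ} (hθ : ‖θ‖ = 1) (f : Fin n → ℂ) {F : (Fin n → ℂ) → ℂ}
    (hF : F ∈ holoL2 n) : shiftFun f θ F ∈ holoL2 n := by
  refine ⟨differentiable_shiftFun f θ hF.1, ?_⟩
  rw [memLp_two_iff (differentiable_shiftFun f θ hF.1)]
  simp_rw [density_mul_shiftFun hθ]
  exact ((memLp_two_iff hF.1).1 hF.2).comp_add_right f

/-- The unitary shift operator on the Bargmann space. -/
def shift (f : Fin n → ℂ) (θ : ℂ) (hθ : ‖θ‖ = 1) : Space n ≃ₗᵢ[ℂ] Space n :=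
  LinearEquiv.isometryOfInner
    { toFun := fun F => (⟨shiftFun f θ F, shiftFun_mem hθ f F.2⟩ : holoL2 n)
      map_add' := fun F G => Subtype.ext ((shiftFun f θ).map_add F.1 G.1)
      map_smul' := fun c F => Subtype.ext ((shiftFun f θ).map_smul c F.1)
      invFun := fun F =>
        (⟨shiftFun (-f) (star θ) F, shiftFun_mem (by rwa [norm_star]) (-f) F.2⟩ : holoL2 n)
      left_inv := fun F => Subtype.ext (shiftFun_neg_shiftFun hθ f F.1)
      right_inv := fun F => Subtype.ext (shiftFun_shiftFun_neg hθ f F.1) }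
    fun F G => by
      change ∫ u, star (shiftFun f θ F (star u)) * shiftFun f θ G (star u) ∂gaussian n =
        ∫ u, star (F (star u)) * G (star u) ∂gaussian n
      rw [integral_gaussian, integral_gaussian]
      simp_rw [density_mul_shiftFun hθ]
      -- After the change of weight, only a translation of Lebesgue measure by `f` remains.
      exact integral_add_right_eq_self
        (fun u => (density u : ℂ) * (star (F (star u)) * G (star u))) f

theorem coe_shift_symm (f : Fin n → ℂ) {θ : ℂ} (hθ : ‖θ‖ = 1) (F : Space n) :
    ((shift f θ hθ).symm F).1 = shiftFun (-f) (star θ) F.1 := rfl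

/-! ### Vacuum, coherent states and the reproducing property. -/

theorem inner_eq (F G : Space n) :
    ⟪F, G⟫_ℂ = ∫ u, star (F (star u)) * G (star u) ∂gaussian n := rfl

/-- The constant function `1` (the vacuum). -/
def vacuum : Space n :=
  (⟨fun _ => 1, differentiable_const 1, memLp_const 1⟩ : holoL2 n)

theorem coe_vacuum : (vacuum : Space n).1 = fun _ => 1 := rfl

theorem norm_vacuum : ‖(vacuum : Space n)‖ = 1 := by
  have h : ⟪(vacuum : Space n), vacuum⟫_ℂ = 1 := by
    rw [inner_eq]
    simp [coe_vacuum]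
  rw [inner_self_eq_norm_sq_to_K] at h
  have h2 : ‖(vacuum : Space n)‖ ^ 2 = 1 := Complex.ofReal_injective (by simpa using h)
  exact (pow_eq_one_iff_of_nonneg (norm_nonneg _) two_ne_zero).1 h2

theorem inner_vacuum (F : Space n) : ⟪vacuum, F⟫_ℂ = F 0 := by
  rw [inner_eq]
  simp only [coe_vacuum, star_one, one_mul]
  exact integral_star_eq_apply_zero F.2.1 (F.2.2.integrable one_le_two)

/-- The coherent state `w ↦ exp (Σⱼ wⱼ z̄ⱼ)`, which reproduces the value at `z`. -/
def coherent (z : Fin n → ℂ) : Space n :=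
  Complex.exp (1 / 2 * ∑ j, z j * star (z j)) • shift (-star z) 1 norm_one vacuum

theorem coherent_apply (z w : Fin n → ℂ) :
    coherent z w = Complex.exp (∑ j, w j * star (z j)) := by
  change Complex.exp _ * (1 * shiftFactor (-star z) w * 1) = _
  rw [one_mul, mul_one, shiftFactor, ← Complex.exp_add]
  congr 1
  simp only [Finset.mul_sum, ← Finset.sum_sub_distrib, ← Finset.sum_add_distrib]
  refine Finset.sum_congr rfl fun j _ => ?_
  simp only [Pi.neg_apply, Pi.star_apply, star_neg, star_star]
  ring

/-- The inverse shift, moved onto `F`, carries the value at `z` to the value at `0`, which the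
vacuum reads off; the scalar in `coherent` cancels the normalisation. -/
theorem inner_coherent (z : Fin n → ℂ) (F : Space n) : ⟪coherent z, F⟫_ℂ = F z := by
  have h1 : ⟪shift (-star z) 1 norm_one vacuum, F⟫_ℂ =
      ((shift (-star z) 1 norm_one).symm F) 0 := by
    rw [← inner_vacuum, ← (shift (-star z) 1 norm_one).inner_map_map vacuum,
      LinearIsometryEquiv.apply_symm_apply]
  rw [coherent, inner_smul_left, h1, coe_shift_symm, shiftFun_apply, neg_neg, star_star,
    zero_add, star_one, one_mul, ← mul_assoc, ← Complex.exp_conj, shiftFactor,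
    ← Complex.exp_add]
  have h2 : (starRingEnd ℂ) (1 / 2 * ∑ j, z j * star (z j)) +
      (-(1 / 2) * ∑ j, star ((star z) j) * (star z) j - ∑ j, (0 : Fin n → ℂ) j * (star z) j) =
        0 := by
    simp [mul_comm, Complex.conj_ofNat]
  rw [h2, Complex.exp_zero, one_mul]

theorem integrable_exp_mul (F : Space n) (w : Fin n → ℂ) :
    Integrable (fun v => Complex.exp (∑ j, w j * v j) * F (star v)) (gaussian n) ∧
      ∫ v, Complex.exp (∑ j, w j * v j) * F (star v) ∂gaussian n = F w := by
  have h : ∀ v : Fin n → ℂ, Complex.exp (∑ j, w j * v j) = star (coherent w (star v)) :=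
    fun v => by
      rw [coherent_apply]
      refine Eq.trans ?_ (Complex.exp_conj _)
      congr 1
      simp [mul_comm]
  simp_rw [h]
  exact ⟨integrable_inner _ _, inner_coherent w F⟩

/-! ### The integral kernel of the shift. -/

theorem shiftKernel_eq (f : Fin n → ℂ) (θ : ℂ) (w v : Fin n → ℂ) :
    shiftKernel f θ w v =
      θ * shiftFactor f w * Complex.exp (∑ j, (w + star f) j * v j) := by
  rw [shiftKernel, shiftFactor, mul_assoc, mul_assoc, ← Complex.exp_add, ← Complex.exp_add]
  congr 2
  simp only [Finset.mul_sum, ← Finset.sum_sub_distrib, ← Finset.sum_add_distrib]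
  refine Finset.sum_congr rfl fun j _ => ?_
  simp only [Pi.add_apply, Pi.star_apply]
  ring

theorem hasKernel_shiftKernel_iff {f : Fin n → ℂ} {θ : ℂ} {U : Space n ≃ₗᵢ[ℂ] Space n} :
    HasKernel U (shiftKernel f θ) ↔ ∀ g, (U g).1 = shiftFun f θ g.1 := by
  have h : ∀ (g : Space n) (w : Fin n → ℂ),
      Integrable (fun v => shiftKernel f θ w v * g (star v)) (gaussian n) ∧
        ∫ v, shiftKernel f θ w v * g (star v) ∂gaussian n = shiftFun f θ g.1 w := fun g w => by
    obtain ⟨h1, h2⟩ := integrable_exp_mul g (w + star f)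
    simp_rw [shiftKernel_eq, mul_assoc (θ * shiftFactor f w)]
    exact ⟨h1.const_mul _, by rw [integral_const_mul, h2, shiftFun_apply]⟩
  refine ⟨fun hU g => funext fun w => (hU g w).2.trans (h g w).2,
    fun hU g w => ⟨(h g w).1, ?_⟩⟩
  rw [(h g w).2, hU]

theorem hasKernel_iff_eq_shift {f : Fin n → ℂ} {θ : ℂ} (hθ : ‖θ‖ = 1)
    {U : Space n ≃ₗᵢ[ℂ] Space n} :
    HasKernel U (shiftKernel f θ) ↔ U = shift f θ hθ := by
  rw [hasKernel_shiftKernel_iff]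
  refine ⟨fun h => LinearIsometryEquiv.ext fun g => Subtype.ext (h g), ?_⟩
  rintro rfl g
  rfl

/-! ### The shift implements the transformation. -/

/-- The domains agree because the weighted translation and its inverse preserve `holoL2 n`, and the
term `z • G` always lies in it. Only a pointwise intertwining identity is left to check. -/
theorem addScalar_maximal_eq_conjugate_shift {f : Fin n → ℂ} {θ : ℂ} (hθ : ‖θ‖ = 1)
    (T : Space n →ₗ[ℂ] ((Fin n → ℂ) → ℂ)) (z : ℂ)
    (hT : ∀ F, T (shift f θ hθ F) + z • (shift f θ hθ F).1 = shiftFun f θ (T F)) :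
    addScalar (maximal T) z = conjugate (shift f θ hθ) (maximal T) := by
  have hT' : ∀ G, T G + z • G.1 = shiftFun f θ (T ((shift f θ hθ).symm G)) := fun G => by
    rw [← hT, LinearIsometryEquiv.apply_symm_apply]
  refine LinearPMap.ext (Submodule.ext fun G => ?_) fun G _ _ => Subtype.ext (hT' G)
  change T G ∈ holoL2 n ↔ T ((shift f θ hθ).symm G) ∈ holoL2 n
  constructor
  · intro h
    have h1 := (holoL2 n).add_mem h ((holoL2 n).smul_mem z G.2)
    rw [hT'] at h1
    rw [← shiftFun_neg_shiftFun hθ f (T ((shift f θ hθ).symm G))]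
    exact shiftFun_mem (by rwa [norm_star]) (-f) h1
  · intro h
    rw [eq_sub_of_add_eq (hT' G)]
    exact (holoL2 n).sub_mem (shiftFun_mem hθ f h) ((holoL2 n).smul_mem z G.2)

/-- The linear form `w ↦ Σⱼ wⱼ zⱼ`. -/
def dotForm (z : Fin n → ℂ) : (Fin n → ℂ) →L[ℂ] ℂ :=
  ∑ j, z j • ContinuousLinearMap.proj (R := ℂ) (φ := fun _ : Fin n => ℂ) j

theorem dotForm_apply (z w : Fin n → ℂ) : dotForm z w = ∑ j, w j * z j := by
  simp [dotForm, mul_comm]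

theorem dotForm_single (z : Fin n → ℂ) (j : Fin n) : dotForm z (Pi.single j 1) = z j := by
  simp [dotForm_apply, Pi.single_apply]

theorem shiftFactor_eq (f w : Fin n → ℂ) : shiftFactor f w =
    Complex.exp (-(1 / 2) * ∑ j, star (f j) * f j) * Complex.exp (-dotForm f w) := by
  rw [shiftFactor, ← Complex.exp_add, dotForm_apply, sub_eq_add_neg]

theorem hasFDerivAt_shiftFactor (f w : Fin n → ℂ) :
    HasFDerivAt (shiftFactor f) (-shiftFactor f w • dotForm f) w := by
  have h := ((dotForm f).hasFDerivAt (x := w)).neg.cexp.const_mul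
    (Complex.exp (-(1 / 2) * ∑ j, star (f j) * f j))
  have h2 : shiftFactor f = fun w => Complex.exp (-(1 / 2) * ∑ j, star (f j) * f j) *
      Complex.exp (-dotForm f w) := funext (shiftFactor_eq f)
  rw [shiftFactor_eq, h2]
  refine h.congr_fderiv (ContinuousLinearMap.ext fun v => ?_)
  change _ * (_ * -dotForm f v) = -(_ * _) * dotForm f v
  simp only [Pi.neg_apply]
  ring

theorem partialDeriv_shift {f : Fin n → ℂ} {θ : ℂ} (hθ : ‖θ‖ = 1) (j : Fin n) (F : Space n) :
    partialDeriv j (shift f θ hθ F) + f j • (shift f θ hθ F).1 =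
      shiftFun f θ (partialDeriv j F) := by
  funext w
  have h1 : HasFDerivAt (fun w => F (w + star f)) (fderiv ℂ F.1 (w + star f)) w :=
    (hasFDerivAt_comp_add_right (star f)).2 (F.2.1 (w + star f)).hasFDerivAt
  have h2 : HasFDerivAt (shift f θ hθ F).1 _ w :=
    ((hasFDerivAt_shiftFactor f w).const_mul θ).mul h1
  change fderiv ℂ (shift f θ hθ F).1 w (Pi.single j 1) +
    f j * (θ * shiftFactor f w * F (w + star f)) =
      θ * shiftFactor f w * fderiv ℂ F.1 (w + star f) (Pi.single j 1)
  rw [h2.fderiv]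
  simp only [add_apply, smul_apply, smul_eq_mul,
    dotForm_single]
  ring

theorem mulCoord_shift {f : Fin n → ℂ} {θ : ℂ} (hθ : ‖θ‖ = 1) (j : Fin n) (F : Space n) :
    mulCoord j (shift f θ hθ F) + star (f j) • (shift f θ hθ F).1 =
      shiftFun f θ (mulCoord j F) := by
  funext w
  change w j * (θ * shiftFactor f w * F (w + star f)) +
    star (f j) * (θ * shiftFactor f w * F (w + star f)) =
      θ * shiftFactor f w * ((w j + star (f j)) * F (w + star f))
  ring

theorem implements_shift (f : Fin n → ℂ) {θ : ℂ} (hθ : ‖θ‖ = 1) :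
    Implements f (shift f θ hθ) := fun j =>
  ⟨addScalar_maximal_eq_conjugate_shift hθ _ _ (partialDeriv_shift hθ j),
    addScalar_maximal_eq_conjugate_shift hθ _ _ (mulCoord_shift hθ j)⟩

/-! ### Every implementing unitary is a shift. -/

/-- The solution of the simultaneous eigenvalue equations of the annihilation operators. -/
theorem apply_eq_of_partialDeriv_eq_smul {F : Space n} {z : Fin n → ℂ}
    (h : ∀ j, partialDeriv j F = z j • F.1) (w : Fin n → ℂ) :
    F w = F 0 * Complex.exp (∑ j, w j * z j) := by
  have h1 : ∀ w, HasFDerivAt F.1 (F w • dotForm z) w := fun w => by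
    have h2 : fderiv ℂ F.1 w = F w • dotForm z := by
      refine ContinuousLinearMap.coe_injective (LinearMap.pi_ext' fun j => ?_)
      refine LinearMap.ext_ring ?_
      have h3 := congrFun (h j) w
      change fderiv ℂ F.1 w (Pi.single j 1) = F w * dotForm z (Pi.single j 1)
      rw [dotForm_single, mul_comm]
      exact h3
    rw [← h2]
    exact (F.2.1 w).hasFDerivAt
  -- Dividing by the expected exponential leaves a function with zero derivative.
  have h4 : ∀ w, HasFDerivAt (fun w => F w * Complex.exp (-dotForm z w)) 0 w := fun w => by
    have h5 := (h1 w).mul ((dotForm z).hasFDerivAt (x := w)).neg.cexp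
    refine h5.congr_fderiv (ContinuousLinearMap.ext fun v => ?_)
    change F w * (Complex.exp (-dotForm z w) * -dotForm z v) +
      Complex.exp (-dotForm z w) * (F w * dotForm z v) = 0
    ring
  have h6 := is_const_of_fderiv_eq_zero (fun w => (h4 w).differentiableAt)
    (fun w => (h4 w).fderiv) w 0
  simp only [map_zero, neg_zero, Complex.exp_zero, mul_one] at h6
  rw [← dotForm_apply, ← h6, mul_assoc, ← Complex.exp_add, neg_add_cancel, Complex.exp_zero,
    mul_one]

theorem partialDeriv_coherent (z : Fin n → ℂ) (j : Fin n) :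
    partialDeriv j (coherent z) = star (z j) • (coherent z).1 := by
  funext w
  have h1 : (coherent z).1 = fun w => Complex.exp (dotForm (star z) w) :=
    funext fun w => (coherent_apply z w).trans (by rw [dotForm_apply]; rfl)
  have h2 := ((dotForm (star z)).hasFDerivAt (x := w)).cexp
  change fderiv ℂ (coherent z).1 w (Pi.single j 1) = star (z j) * (coherent z).1 w
  rw [h1, h2.fderiv]
  simp only [smul_apply, smul_eq_mul, dotForm_single, Pi.star_apply]
  ring

theorem map_symm_of_addScalar_eq_conjugate {U : Space n ≃ₗᵢ[ℂ] Space n}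
    {T : Space n →ₗ[ℂ] ((Fin n → ℂ) → ℂ)} {z : ℂ}
    (h : addScalar (maximal T) z = conjugate U (maximal T)) {G K : Space n} (hG : T G = K.1) :
    T (U.symm G) = (U.symm (K + z • G)).1 := by
  have hd : G ∈ (addScalar (maximal T) z).domain := show T G ∈ holoL2 n from hG ▸ K.2
  have hd' : G ∈ (conjugate U (maximal T)).domain := h ▸ hd
  have h1 : addScalar (maximal T) z ⟨G, hd⟩ = conjugate U (maximal T) ⟨G, hd'⟩ :=
    (LinearPMap.ext_iff.1 h).2 (x := G) (hf := hd) (hg := hd')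
  have h2 : addScalar (maximal T) z ⟨G, hd⟩ = K + z • G := Subtype.ext (congrArg (· + z • G.1) hG)
  rw [← h2, h1]
  exact (congrArg Subtype.val (U.symm_apply_apply (⟨T (U.symm G), hd'⟩ : holoL2 n))).symm

/-- The preceding transport rule for `U⁻¹`, applied to `G = U H`; the domain equality is what puts
`U H` in the domain of `T`. -/
theorem map_apply_of_addScalar_eq_conjugate {U : Space n ≃ₗᵢ[ℂ] Space n}
    {T : Space n →ₗ[ℂ] ((Fin n → ℂ) → ℂ)} {z : ℂ}
    (h : addScalar (maximal T) z = conjugate U (maximal T)) {H K : Space n} (hH : T H = K.1) :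
    T (U H) = (U K - z • U H).1 := by
  have hd' : U H ∈ (conjugate U (maximal T)).domain :=
    show T (U.symm (U H)) ∈ holoL2 n by rw [U.symm_apply_apply, hH]; exact K.2
  have hd : U H ∈ (addScalar (maximal T) z).domain := h ▸ hd'
  obtain ⟨L, hL⟩ : ∃ L : Space n, T (U H) = L.1 := ⟨(⟨T (U H), hd⟩ : holoL2 n), rfl⟩
  have h1 := map_symm_of_addScalar_eq_conjugate h hL
  rw [U.symm_apply_apply, hH] at h1
  have h2 := congrArg U (Subtype.ext h1 : K = _)
  rw [U.apply_symm_apply] at h2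
  rw [h2, add_sub_cancel_right, hL]

theorem Implements.exists_apply_eq_shiftFun {f : Fin n → ℂ} {U : Space n ≃ₗᵢ[ℂ] Space n}
    (h : Implements f U) : ∃ θ : ℂ, ∀ g, (U g).1 = shiftFun f θ g.1 := by
  have h1 : ∀ z w : Fin n → ℂ, U.symm (coherent z) w =
      U.symm (coherent z) 0 * coherent (z + star f) w := fun z w => by
    rw [coherent_apply]
    -- `U⁻¹ e_z` has eigenvalues `z̄ⱼ + fⱼ`, those of `e_{z + f̄}`.
    refine apply_eq_of_partialDeriv_eq_smul (z := fun j => star ((z + star f) j)) (fun j => ?_) w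
    rw [map_symm_of_addScalar_eq_conjugate (h j).1 (K := star (z j) • coherent z)
      (partialDeriv_coherent z j), ← add_smul, map_smul]
    simp only [Pi.add_apply, Pi.star_apply, star_add, star_star]
    rfl
  have h2 : ∀ (g : Space n) (z : Fin n → ℂ),
      U g z = star (U.symm (coherent z) 0) * g (z + star f) := fun g z => by
    have h3 : U.symm (coherent z) = U.symm (coherent z) 0 • coherent (z + star f) :=
      Subtype.ext (funext (h1 z))
    rw [← inner_coherent z (U g), ← inner_coherent (z + star f) g]
    calc ⟪coherent z, U g⟫_ℂ = ⟪U.symm (coherent z), g⟫_ℂ := by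
          rw [← U.inner_map_map (U.symm (coherent z)), U.apply_symm_apply]
      _ = _ := by
          rw [h3, inner_smul_left, ← h3]
          rfl
  -- Since `aⱼ 1 = 0`, `U 1` is annihilated by `aⱼ + fⱼ`.
  have h4 : ∀ w, U vacuum w = U vacuum 0 * Complex.exp (∑ j, w j * -f j) := by
    refine apply_eq_of_partialDeriv_eq_smul (z := fun j => -f j) fun j => ?_
    have h5 : partialDeriv j (vacuum : Space n) = (0 : Space n).1 := by
      funext w
      change fderiv ℂ (fun _ => (1 : ℂ)) w (Pi.single j 1) = 0
      simp
    have h6 := map_apply_of_addScalar_eq_conjugate (h j).1 h5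
    rw [map_zero, zero_sub, ← neg_smul] at h6
    exact h6
  -- The exponential cancels the normalisation `exp(-½|f|²)` inside `shiftFactor`.
  refine ⟨U vacuum 0 * Complex.exp (1 / 2 * ∑ j, star (f j) * f j),
    fun g => funext fun z => ?_⟩
  have h7 : U vacuum z = star (U.symm (coherent z) 0) := by
    rw [h2, coe_vacuum, mul_one]
  change U g z = _
  have h8 : Complex.exp (∑ j, z j * -f j) =
      Complex.exp (1 / 2 * ∑ j, star (f j) * f j) * shiftFactor f z := by
    rw [shiftFactor, ← Complex.exp_add]
    congr 1
    simp only [mul_neg, Finset.sum_neg_distrib]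
    ring
  rw [h2, ← h7, h4, shiftFun_apply, h8]
  ring

/-- On the vacuum, `U` is `θ` times the unitary shift of phase `1`; comparing norms gives the
modulus. -/
theorem norm_eq_one_of_apply_eq_shiftFun {f : Fin n → ℂ} {θ : ℂ} {U : Space n ≃ₗᵢ[ℂ] Space n}
    (h : ∀ g, (U g).1 = shiftFun f θ g.1) : ‖θ‖ = 1 := by
  have h1 : U vacuum = θ • shift f 1 norm_one vacuum := by
    refine Subtype.ext ((h vacuum).trans (funext fun w => ?_))
    change θ * shiftFactor f w * 1 = θ * (1 * shiftFactor f w * 1)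
    ring
  have h2 := congrArg norm h1
  rw [norm_smul, LinearIsometryEquiv.norm_map, LinearIsometryEquiv.norm_map, norm_vacuum,
    mul_one] at h2
  exact h2.symm

end Bargmann

end

/-- For every phase `θ` the stated kernel is the kernel of a (unique) unitary operator, which
implements the transformation, and every unitary operator which implements the transformation has
the stated kernel for some phase `θ`. -/
theorem theorem4p1 (n : ℕ) (f : Fin n → ℂ) :
    (∀ θ : ℂ, ‖θ‖ = 1 →
      (∃! U : Bargmann.Space n ≃ₗᵢ[ℂ] Bargmann.Space n,
        Bargmann.HasKernel U (Bargmann.shiftKernel f θ)) ∧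
      (∀ U : Bargmann.Space n ≃ₗᵢ[ℂ] Bargmann.Space n,
        Bargmann.HasKernel U (Bargmann.shiftKernel f θ) → Bargmann.Implements f U)) ∧
    (∀ U : Bargmann.Space n ≃ₗᵢ[ℂ] Bargmann.Space n, Bargmann.Implements f U →
      ∃ θ : ℂ, ‖θ‖ = 1 ∧ Bargmann.HasKernel U (Bargmann.shiftKernel f θ)) := by
  refine ⟨fun θ hθ => ⟨⟨Bargmann.shift f θ hθ, (Bargmann.hasKernel_iff_eq_shift hθ).2 rfl,
    fun U hU => (Bargmann.hasKernel_iff_eq_shift hθ).1 hU⟩, fun U hU => ?_⟩, fun U hU => ?_⟩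
  · rw [(Bargmann.hasKernel_iff_eq_shift hθ).1 hU]
    exact Bargmann.implements_shift f hθ
  · obtain ⟨θ, hU'⟩ := hU.exists_apply_eq_shiftFun
    exact ⟨θ, Bargmann.norm_eq_one_of_apply_eq_shiftFun hU',
      Bargmann.hasKernel_shiftKernel_iff.2 hU'⟩
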